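/- Let $\mathsf G$ be a discrete group with unit $\mathsf e$. An \emph{admissible algebra} $\mathcal L(\mathsf G)$ is a linear subspace of $\ell^1(\mathsf G)$ with its own complete norm $\|\cdot\|_{\mathcal L}$, stronger than the $\ell^1$-norm, which is solid (if $|k|\le|l|$ pointwise and $l\in\mathcal L(\mathsf G)$, then $k\in\mathcal L(\mathsf G)$ and $\|k\|_{\mathcal L}\le\|l\|_{\mathcal L}$) and which is a unital Banach $^*$-algebra (submultiplicative norm, isometric involution) for the convolution $(k\star l)(x)=\sum_{y}k(y)\,l(y^{-1}x)$ and the involution $k^\star(x)=\overline{k(x^{-1})}$. For a C*-algebra $\mathcal A$ (unital or not), $\mathcal L(\mathsf G;\mathcal A)$ is the Banach $^*$-algebra of all $f:\mathsf G\to\mathcal A$ with $\|f(\cdot)\|_{\mathcal A}\in\mathcal L(\mathsf G)$, with product $(f\star g)(x)=\sum_y f(y)\,g(y^{-1}x)$, involution $f^\star(x)=f(x^{-1})^*$ and norm $\big\|\,\|f(\cdot)\|_{\mathcal A}\big\|_{\mathcal L}$. A Banach $^*$-algebra $\mathcal B$ is \emph{symmetric} if the spectrum of $B^*B$ is contained in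 $[0,\infty)$ for every $B\in\mathcal B$ (the spectrum being computed in the unitization if $\mathcal B$ has no unit). The group $\mathsf G$ is \emph{rigidly $\mathcal L$-symmetric} if $\mathcal L(\mathsf G;\mathcal A)$ is symmetric for every C*-algebra $\mathcal A$. Let $\mathcal A(\mathsf G)$ be a unital C*-subalgebra of $\ell^\infty(\mathsf G)$ that is invariant under the translations $[\alpha_x(\varphi)](y)=\varphi(x^{-1}y)$. An \emph{$\mathcal A(\mathsf G)$-valued $2$-cocycle} is a map $\omega$ from $\mathsf G\times\mathsf G$ to the unitary group of $\mathcal A(\mathsf G)$ with $$\omega(x,y)\,\omega(xy,z)=\alpha_x[\omega(y,z)]\,\omega(x,yz),\qquad \omega(x,\mathsf e)=1=\omega(\mathsf e,x)$$ for all $x,y,z\in\mathsf G$; write $\omega(x,y;z)$ for the value of the function $\omega(x,y)$ at $z$. Let $\mathfrak K^{\mathcal L,\mathcal A}_{\omega}(\mathsf G\times\mathsf G)$ be the space of all $K:\mathsf G\times\mathsf G\to\mathbb C$ such that for some $k\in\mathcal L(\mathsf G)$ one has $|K(x,y)|\le|k(xy^{-1})|$ for all $x,y$, and such that $z\mapsto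 K(xz,yz)$ belongs to $\mathcal A(\mathsf G)$ for all $x,y$. It is a Banach $^*$-algebra with $$(K\bullet_\omega M)(x,y)=\sum_{z\in\mathsf G}K(x,z)\,M(z,y)\,\omega(xz^{-1},zy^{-1};x),$$ $$K^{\bullet_\omega}(x,y)=\overline{\omega(xy^{-1},yx^{-1};x)}\;\overline{K(y,x)},$$ $$\|K\|=\inf\{\|k\|_{\mathcal L}\mid |K(x,y)|\le|k(xy^{-1})|\ \ \forall\,x,y\in\mathsf G\}.$$ \textbf{Claim.} If $\mathcal L(\mathsf G)$ is an admissible algebra, $\mathsf G$ is rigidly $\mathcal L$-symmetric, and $\mathcal A(\mathsf G)$ is a translation-invariant unital C*-subalgebra of $\ell^\infty(\mathsf G)$, then the Banach $^*$-algebra $\mathfrak K^{\mathcal L,\mathcal A}_{\omega}(\mathsf G\times\mathsf G)$ is symmetric for every $\mathcal A(\mathsf G)$-valued $2$-cocycle $\omega$. -/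

import Mathlib

open scoped ENNReal ComplexOrder

universe u

noncomputable section

namespace TwistedKernel

/-! ## Symmetric star-algebras -/

/-- A complex Banach `*`-algebra `B` (unital or not) is symmetric if the spectrum of `b* b` is
contained in `[0, ∞)` for every `b`. The spectrum is the quasispectrum, i.e. the spectrum in the
unitization (for unital `B` it is the usual spectrum together with `0`).
The inequality `0 ≤ z` in `ℂ` says that `z` is real and nonnegative. -/
def IsSymmetric (B : Type*) [NonUnitalNormedRing B] [CompleteSpace B] [NormedSpace ℂ B]
    [IsScalarTower ℂ B B] [SMulCommClass ℂ B B] [StarRing B] [StarModule ℂ B]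
    [NormedStarGroup B] : Prop :=
  ∀ b : B, ∀ z ∈ quasispectrum ℂ (star b * b), 0 ≤ z

/-! ## Convolution and admissible algebras -/

section Conv

variable {G : Type u} [Group G]

/-- Convolution on the discrete group `G`: `(f ⋆ g)(x) = ∑ y, f y * g (y⁻¹ x)`. -/
def conv {R : Type*} [NonUnitalNormedRing R] (f g : G → R) : G → R :=
  fun x => ∑' y, f y * g (y⁻¹ * x)

/-- The involution `f⋆(x) = f(x⁻¹)*`. -/
def invol {R : Type*} [Star R] (f : G → R) : G → R :=
  fun x => star (f x⁻¹)

end Conv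

/-- An admissible algebra on `G`: a linear subspace `carrier` of `ℓ¹(G)` with its own complete norm
`nrm`, stronger than the `ℓ¹`-norm, which is solid and is a unital Banach `*`-algebra for
convolution and the involution `k⋆(x) = conj k(x⁻¹)`.
Only the values of `nrm` on `carrier` are meaningful. -/
structure AdmissibleAlgebra (G : Type u) [Group G] where
  carrier : Submodule ℂ (G → ℂ)
  nrm : (G → ℂ) → ℝ
  summable : ∀ k ∈ carrier, Summable fun x => ‖k x‖
  nrm_add_le : ∀ k ∈ carrier, ∀ l ∈ carrier, nrm (k + l) ≤ nrm k + nrm l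
  nrm_smul : ∀ (c : ℂ), ∀ k ∈ carrier, nrm (c • k) = ‖c‖ * nrm k
  stronger : ∃ C : ℝ, ∀ k ∈ carrier, ∑' x, ‖k x‖ ≤ C * nrm k
  complete : ∀ u : ℕ → G → ℂ, (∀ n, u n ∈ carrier) →
    (∀ ε > 0, ∃ N, ∀ m ≥ N, ∀ n ≥ N, nrm (u m - u n) < ε) →
    ∃ k ∈ carrier, Filter.Tendsto (fun n => nrm (u n - k)) Filter.atTop (nhds 0)
  solid : ∀ k : G → ℂ, ∀ l ∈ carrier, (∀ x, ‖k x‖ ≤ ‖l x‖) → k ∈ carrier ∧ nrm k ≤ nrm l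
  conv_mem : ∀ k ∈ carrier, ∀ l ∈ carrier, conv k l ∈ carrier
  nrm_conv_le : ∀ k ∈ carrier, ∀ l ∈ carrier, nrm (conv k l) ≤ nrm k * nrm l
  invol_mem : ∀ k ∈ carrier, invol k ∈ carrier
  nrm_invol : ∀ k ∈ carrier, nrm (invol k) = nrm k
  one_mem : Set.indicator {(1 : G)} (fun _ => (1 : ℂ)) ∈ carrier

/-! ### Auxiliary facts on dominated kernels -/

section Aux

variable {G : Type u} [Group G]

/-- The composition of two kernels, with scalar weights `w`. -/
def wmul {R : Type*} [NonUnitalNormedRing R] [Module ℂ R] (w : G → G → G → ℂ) (K L : G → G → R) :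
    G → G → R :=
  fun x y => ∑' z, w x z y • (K x z * L z y)

theorem summable_dom {k l : G → ℝ} (hk0 : ∀ x, 0 ≤ k x) (hl0 : ∀ x, 0 ≤ l x)
    (hk : Summable k) (hl : Summable l) (x y : G) :
    Summable fun z => k (x * z⁻¹) * l (z * y⁻¹) := by
  have h1 : Summable fun z => k (x * z⁻¹) :=
    hk.comp_injective (i := fun z => x * z⁻¹) (fun a b h => by simpa using h)
  refine Summable.of_nonneg_of_le (fun z => mul_nonneg (hk0 _) (hl0 _)) (fun z => ?_)
    (h1.mul_right (∑' a, l a))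
  exact mul_le_mul_of_nonneg_left (hl.le_tsum _ (fun j _ => hl0 j)) (hk0 _)

variable {R : Type*} [NonUnitalNormedRing R] [NormedSpace ℂ R]

theorem norm_wmul_term {w : G → G → G → ℂ} (hw : ∀ x z y, ‖w x z y‖ = 1) {K L : G → G → R}
    {k l : G → ℝ} (hK : ∀ x y, ‖K x y‖ ≤ k (x * y⁻¹)) (hL : ∀ x y, ‖L x y‖ ≤ l (x * y⁻¹))
    (x y z : G) : ‖w x z y • (K x z * L z y)‖ ≤ k (x * z⁻¹) * l (z * y⁻¹) := by
  rw [norm_smul, hw, one_mul]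
  exact (norm_mul_le _ _).trans
    (mul_le_mul (hK _ _) (hL _ _) (norm_nonneg _) ((norm_nonneg _).trans (hK x z)))

theorem summable_wmul [CompleteSpace R] {w : G → G → G → ℂ} (hw : ∀ x z y, ‖w x z y‖ = 1)
    {K L : G → G → R} {k l : G → ℝ} (hk0 : ∀ x, 0 ≤ k x) (hl0 : ∀ x, 0 ≤ l x)
    (hk : Summable k) (hl : Summable l)
    (hK : ∀ x y, ‖K x y‖ ≤ k (x * y⁻¹)) (hL : ∀ x y, ‖L x y‖ ≤ l (x * y⁻¹)) (x y : G) :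
    Summable fun z => w x z y • (K x z * L z y) :=
  Summable.of_norm_bounded (summable_dom hk0 hl0 hk hl x y) (norm_wmul_term hw hK hL x y)

theorem summable_triple {k l m : G → ℝ} (hk0 : ∀ x, 0 ≤ k x) (hl0 : ∀ x, 0 ≤ l x)
    (hm0 : ∀ x, 0 ≤ m x) (hk : Summable k) (hl : Summable l) (hm : Summable m) (x y : G) :
    Summable fun p : G × G => k (x * p.1⁻¹) * l (p.1 * p.2⁻¹) * m (p.2 * y⁻¹) := by
  have h1 : Summable fun p : G × G => k p.1 * l p.2 := hk.mul_of_nonneg hl hk0 hl0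
  have h2 : Summable fun p : G × G => k (x * p.1⁻¹) * l (p.1 * p.2⁻¹) :=
    h1.comp_injective (i := fun p : G × G => (x * p.1⁻¹, p.1 * p.2⁻¹)) (by
      rintro ⟨a, b⟩ ⟨c, d⟩ h
      simp only [Prod.mk.injEq, mul_right_inj, inv_inj] at h
      obtain ⟨rfl, h⟩ := h
      simpa using h)
  refine Summable.of_nonneg_of_le
    (fun z => mul_nonneg (mul_nonneg (hk0 _) (hl0 _)) (hm0 _)) (fun z => ?_)
    (h2.mul_right (∑' a, m a))
  exact mul_le_mul_of_nonneg_left (hm.le_tsum _ (fun j _ => hm0 j))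
    (mul_nonneg (hk0 _) (hl0 _))

theorem wmul_assoc [CompleteSpace R] [IsScalarTower ℂ R R] [SMulCommClass ℂ R R]
    {w : G → G → G → ℂ} (hw : ∀ x z y, ‖w x z y‖ = 1)
    (hc : ∀ x b a y, w x b a * w x a y = w b a y * w x b y)
    {K L M : G → G → R} {k l m : G → ℝ} (hk0 : ∀ x, 0 ≤ k x) (hl0 : ∀ x, 0 ≤ l x)
    (hm0 : ∀ x, 0 ≤ m x) (hk : Summable k) (hl : Summable l) (hm : Summable m)
    (hK : ∀ x y, ‖K x y‖ ≤ k (x * y⁻¹)) (hL : ∀ x y, ‖L x y‖ ≤ l (x * y⁻¹))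
    (hM : ∀ x y, ‖M x y‖ ≤ m (x * y⁻¹)) :
    wmul w (wmul w K L) M = wmul w K (wmul w L M) := by
  funext x y
  have hL1 : ∀ a, w x a y • (wmul w K L x a * M a y)
      = ∑' b, (w x b a * w x a y) • (K x b * L b a * M a y) := by
    intro a
    unfold wmul
    rw [← (summable_wmul hw hk0 hl0 hk hl hK hL x a).tsum_mul_right, ← tsum_const_smul'']
    refine tsum_congr fun b => ?_
    rw [smul_mul_assoc, smul_smul, mul_comm]
  have hR1 : ∀ b, w x b y • (K x b * wmul w L M b y)
      = ∑' a, (w x b a * w x a y) • (K x b * L b a * M a y) := by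
    intro b
    unfold wmul
    rw [← (summable_wmul hw hl0 hm0 hl hm hL hM b y).tsum_mul_left, ← tsum_const_smul'']
    refine tsum_congr fun a => ?_
    rw [mul_smul_comm, smul_smul, mul_comm, hc, mul_assoc]
  change ∑' a, w x a y • (wmul w K L x a * M a y) = ∑' b, w x b y • (K x b * wmul w L M b y)
  rw [tsum_congr hL1, tsum_congr hR1]
  refine Summable.tsum_comm (f := fun b a => (w x b a * w x a y) • (K x b * L b a * M a y)) ?_
  refine Summable.of_norm_bounded (summable_triple hk0 hl0 hm0 hk hl hm x y) ?_
  rintro ⟨b, a⟩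
  simp only [Function.uncurry]
  rw [norm_smul, norm_mul, hw, hw, one_mul, one_mul]
  refine (norm_mul_le _ _).trans (mul_le_mul ((norm_mul_le _ _).trans
    (mul_le_mul (hK _ _) (hL _ _) (norm_nonneg _) ?_)) (hM _ _) (norm_nonneg _) ?_)
  · exact hk0 _
  · exact mul_nonneg (hk0 _) (hl0 _)

theorem conv_eq_wmul (f g : G → R) (x y : G) :
    conv f g (x * y⁻¹)
      = wmul (fun _ _ _ => 1) (fun a b => f (a * b⁻¹)) (fun a b => g (a * b⁻¹)) x y := by
  unfold conv wmul
  rw [← ((Equiv.inv G).trans (Equiv.mulLeft x)).tsum_eq]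
  refine tsum_congr fun z => ?_
  simp [mul_assoc]

theorem summable_conv {R : Type*} [NonUnitalNormedRing R] [CompleteSpace R] {f g : G → R} (hf : Summable fun x => ‖f x‖)
    (hg : Summable fun x => ‖g x‖) (x : G) : Summable fun y => f y * g (y⁻¹ * x) := by
  refine Summable.of_norm_bounded (g := fun y => ‖f y‖ * ∑' a, ‖g a‖)
    (hf.mul_right _) (fun y => (norm_mul_le _ _).trans ?_)
  exact mul_le_mul_of_nonneg_left (hg.le_tsum _ (fun j _ => norm_nonneg _)) (norm_nonneg _)

theorem conv_assoc [CompleteSpace R] [IsScalarTower ℂ R R] [SMulCommClass ℂ R R]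
    {f g h : G → R} (hf : Summable fun x => ‖f x‖)
    (hg : Summable fun x => ‖g x‖) (hh : Summable fun x => ‖h x‖) :
    conv (conv f g) h = conv f (conv g h) := by
  have key := wmul_assoc (w := fun _ _ _ : G => (1 : ℂ)) (by simp) (by simp)
    (K := fun a b => f (a * b⁻¹)) (L := fun a b => g (a * b⁻¹)) (M := fun a b => h (a * b⁻¹))
    (fun x => norm_nonneg (f x)) (fun x => norm_nonneg (g x)) (fun x => norm_nonneg (h x))
    hf hg hh (fun _ _ => le_rfl) (fun _ _ => le_rfl) (fun _ _ => le_rfl)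
  funext x
  have e1 := conv_eq_wmul (conv f g) h x 1
  have e2 := conv_eq_wmul f (conv g h) x 1
  simp only [inv_one, mul_one] at e1 e2
  rw [e1, e2]
  have h1 : (fun a b => conv f g (a * b⁻¹)) = wmul (fun _ _ _ => 1) (fun a b => f (a * b⁻¹))
      (fun a b => g (a * b⁻¹)) := by
    funext a b; exact conv_eq_wmul f g a b
  have h2 : (fun a b => conv g h (a * b⁻¹)) = wmul (fun _ _ _ => 1) (fun a b => g (a * b⁻¹))
      (fun a b => h (a * b⁻¹)) := by
    funext a b; exact conv_eq_wmul g h a b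
  rw [h1, h2, key]

end Aux

/-! ### Auxiliary facts on admissible algebras -/

namespace AdmissibleAlgebra

section Abs

variable {G : Type u}

/-- The pointwise absolute value of a vector-valued function, as a complex function. -/
def abs {R : Type*} [Norm R] (f : G → R) : G → ℂ := fun x => ((‖f x‖ : ℝ) : ℂ)

@[simp] theorem norm_abs {R : Type*} [NormedAddCommGroup R] (f : G → R) (x : G) :
    ‖abs f x‖ = ‖f x‖ := by simp [abs]

end Abs

variable {G : Type u} [Group G] (L : AdmissibleAlgebra G)

theorem abs_mem {k : G → ℂ} (hk : k ∈ L.carrier) : abs k ∈ L.carrier :=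
  (L.solid _ k hk (by simp)).1

theorem nrm_abs {k : G → ℂ} (hk : k ∈ L.carrier) : L.nrm (abs k) = L.nrm k :=
  le_antisymm (L.solid _ k hk (by simp)).2 (L.solid _ _ (L.abs_mem hk) (by simp)).2

theorem nrm_zero : L.nrm 0 = 0 := by
  have := L.nrm_smul 0 0 L.carrier.zero_mem
  simpa using this

theorem nrm_neg {k : G → ℂ} (hk : k ∈ L.carrier) : L.nrm (-k) = L.nrm k := by
  have := L.nrm_smul (-1) k hk
  simpa using this

theorem nrm_nonneg {k : G → ℂ} (hk : k ∈ L.carrier) : 0 ≤ L.nrm k := by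
  have h := L.nrm_add_le k hk (-k) (L.carrier.neg_mem hk)
  rw [add_neg_cancel, L.nrm_zero, L.nrm_neg hk] at h
  linarith

theorem exists_bound : ∃ C : ℝ, 0 ≤ C ∧ ∀ k ∈ L.carrier, ∀ x, ‖k x‖ ≤ C * L.nrm k := by
  obtain ⟨C, hC⟩ := L.stronger
  refine ⟨max C 0, le_max_right _ _, fun k hk x => ?_⟩
  calc ‖k x‖ ≤ ∑' x, ‖k x‖ := (L.summable k hk).le_tsum x (fun j _ => norm_nonneg _)
    _ ≤ C * L.nrm k := hC k hk
    _ ≤ max C 0 * L.nrm k := mul_le_mul_of_nonneg_right (le_max_left _ _) (L.nrm_nonneg hk)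

theorem conv_abs_apply {k l : G → ℂ} (x : G) :
    conv (abs k) (abs l) x = ((∑' y, ‖k y‖ * ‖l (y⁻¹ * x)‖ : ℝ) : ℂ) := by
  simp [conv, abs, Complex.ofReal_tsum]

theorem norm_conv_abs {k l : G → ℂ} (x : G) :
    ‖conv (abs k) (abs l) x‖ = ∑' y, ‖k y‖ * ‖l (y⁻¹ * x)‖ := by
  rw [conv_abs_apply, Complex.norm_real, Real.norm_eq_abs, abs_of_nonneg]
  exact tsum_nonneg fun y => by positivity

theorem conv_abs_mem {k l : G → ℂ} (hk : k ∈ L.carrier) (hl : l ∈ L.carrier) :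
    conv (abs k) (abs l) ∈ L.carrier :=
  L.conv_mem _ (L.abs_mem hk) _ (L.abs_mem hl)

theorem nrm_conv_abs_le {k l : G → ℂ} (hk : k ∈ L.carrier) (hl : l ∈ L.carrier) :
    L.nrm (conv (abs k) (abs l)) ≤ L.nrm k * L.nrm l := by
  refine (L.nrm_conv_le _ (L.abs_mem hk) _ (L.abs_mem hl)).trans ?_
  rw [L.nrm_abs hk, L.nrm_abs hl]

theorem nrm_sum_le {u : ℕ → G → ℂ} (hu : ∀ n, u n ∈ L.carrier) (s : Finset ℕ) :
    L.nrm (∑ i ∈ s, u i) ≤ ∑ i ∈ s, L.nrm (u i) := by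
  classical
  induction s using Finset.induction_on with
  | empty => simp [L.nrm_zero]
  | insert a s ha ih =>
    rw [Finset.sum_insert ha, Finset.sum_insert ha]
    exact (L.nrm_add_le _ (hu a) _ (L.carrier.sum_mem fun i _ => hu i)).trans (by linarith)

/-- An absolutely convergent series of nonnegative elements of an admissible algebra converges. -/
theorem exists_sum {u : ℕ → G → ℂ} (hu : ∀ n, u n ∈ L.carrier)
    (hs : Summable fun n => L.nrm (u n)) :
    ∃ k ∈ L.carrier, (∀ x, Summable fun n => ‖u n x‖) ∧
      (∀ x, HasSum (fun n => u n x) (k x)) ∧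
      Filter.Tendsto (fun n => L.nrm (k - ∑ i ∈ Finset.range n, u i)) Filter.atTop (nhds 0) := by
  obtain ⟨C, hC0, hC⟩ := L.exists_bound
  have hmem : ∀ n, ∑ i ∈ Finset.range n, u i ∈ L.carrier :=
    fun n => L.carrier.sum_mem fun i _ => hu i
  have hCau := hs.hasSum.tendsto_sum_nat.cauchySeq
  rw [Metric.cauchySeq_iff] at hCau
  have hdiff : ∀ m n, n ≤ m → L.nrm (∑ i ∈ Finset.range m, u i - ∑ i ∈ Finset.range n, u i)
      ≤ dist (∑ i ∈ Finset.range m, L.nrm (u i)) (∑ i ∈ Finset.range n, L.nrm (u i)) := by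
    intro m n h
    rw [← Finset.sum_Ico_eq_sub _ h, Real.dist_eq, ← Finset.sum_Ico_eq_sub _ h]
    exact (L.nrm_sum_le hu _).trans (le_abs_self _)
  obtain ⟨k, hk, hlim⟩ := L.complete _ hmem (fun ε hε => by
    obtain ⟨N, hN⟩ := hCau ε hε
    refine ⟨N, fun m hm n hn => ?_⟩
    rcases le_total n m with h | h
    · exact (hdiff m n h).trans_lt (hN m hm n hn)
    · rw [← L.nrm_neg (L.carrier.sub_mem (hmem m) (hmem n)), neg_sub]
      exact (hdiff n m h).trans_lt (hN n hn m hm))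
  have hsx : ∀ x, Summable fun n => ‖u n x‖ := fun x =>
    Summable.of_nonneg_of_le (fun n => norm_nonneg _) (fun n => hC _ (hu n) x) (hs.mul_left C)
  refine ⟨k, hk, hsx, fun x => ?_, ?_⟩
  · have h1 := (hsx x).of_norm.hasSum
    have h2 : Filter.Tendsto (fun n => ∑ i ∈ Finset.range n, u i x) Filter.atTop
        (nhds (k x)) := by
      rw [tendsto_iff_norm_sub_tendsto_zero]
      refine squeeze_zero (fun n => norm_nonneg _) (fun n => ?_)
        (by simpa using hlim.const_mul C)
      have := hC _ (L.carrier.sub_mem (hmem n) hk) x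
      simpa using this
    rwa [tendsto_nhds_unique h1.tendsto_sum_nat h2] at h1
  · refine hlim.congr fun n => ?_
    rw [← L.nrm_neg (L.carrier.sub_mem (hmem n) hk), neg_sub]

end AdmissibleAlgebra

/-! ## The algebras `𝓛(G; A)` and rigid symmetry -/

section Vector

variable {G : Type u} [Group G]

/-- The space `𝓛(G; A)` of functions `f : G → A` with `‖f(·)‖ ∈ 𝓛(G)`. -/
def vectorSubmodule (L : AdmissibleAlgebra G) (A : Type*) [NonUnitalCStarAlgebra A] :
    Submodule ℂ (G → A) where
  carrier := {f | (fun x => ((‖f x‖ : ℝ) : ℂ)) ∈ L.carrier}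
  zero_mem' := by
    have : (fun _ : G => ((‖(0 : A)‖ : ℝ) : ℂ)) = 0 := by funext; simp
    simp only [Set.mem_ofPred_eq, Pi.zero_apply, this, L.carrier.zero_mem]
  add_mem' := by
    intro f g hf hg
    refine (L.solid _ _ (L.carrier.add_mem hf hg) fun x => ?_).1
    simp only [Pi.add_apply, ← Complex.ofReal_add, Complex.norm_real, norm_norm]
    exact (norm_add_le _ _).trans (le_abs_self _)
  smul_mem' := by
    intro c f hf
    refine (L.solid _ _ (L.carrier.smul_mem c hf) fun x => ?_).1
    simp [norm_smul]

/-- The algebra `𝓛(G; A)`: the space of `A`-valued functions `f` with `‖f(·)‖ ∈ 𝓛(G)`, with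
convolution `(f ⋆ g)(x) = ∑ y, f(y) g(y⁻¹x)`, involution `f⋆(x) = f(x⁻¹)*` and norm
`‖ ‖f(·)‖ ‖_𝓛`. -/
def VectorAlgebra (L : AdmissibleAlgebra G) (A : Type*) [NonUnitalCStarAlgebra A] : Type _ :=
  ↥(vectorSubmodule L A)

namespace VectorAlgebra

variable {L : AdmissibleAlgebra G} {A : Type*} [NonUnitalCStarAlgebra A]

instance : AddCommGroup (VectorAlgebra L A) := inferInstanceAs (AddCommGroup (vectorSubmodule L A))

instance : Module ℂ (VectorAlgebra L A) := inferInstanceAs (Module ℂ (vectorSubmodule L A))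

/-- An element of `𝓛(G; A)` from its underlying function. -/
def mk (f : G → A) (hf : f ∈ vectorSubmodule L A) : VectorAlgebra L A := ⟨f, hf⟩

/-- The function underlying an element of `𝓛(G; A)`. -/
def toFun (f : VectorAlgebra L A) : G → A := f.1

@[ext] theorem ext {f g : VectorAlgebra L A} (h : f.toFun = g.toFun) : f = g := Subtype.ext h

@[simp] theorem toFun_mk (f : G → A) (hf : f ∈ vectorSubmodule L A) : (mk f hf).toFun = f := rfl
@[simp] theorem toFun_add (f g : VectorAlgebra L A) : (f + g).toFun = f.toFun + g.toFun := rfl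
@[simp] theorem toFun_zero : (0 : VectorAlgebra L A).toFun = 0 := rfl
@[simp] theorem toFun_neg (f : VectorAlgebra L A) : (-f).toFun = -f.toFun := rfl
@[simp] theorem toFun_sub (f g : VectorAlgebra L A) : (f - g).toFun = f.toFun - g.toFun := rfl
@[simp] theorem toFun_smul (c : ℂ) (f : VectorAlgebra L A) : (c • f).toFun = c • f.toFun := rfl

theorem abs_mem (f : VectorAlgebra L A) : AdmissibleAlgebra.abs f.toFun ∈ L.carrier := f.2

theorem summable_norm (f : VectorAlgebra L A) : Summable fun x => ‖f.toFun x‖ := by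
  simpa [AdmissibleAlgebra.abs] using L.summable _ f.abs_mem

theorem norm_conv_le (f g : VectorAlgebra L A) (x : G) : ‖conv f.toFun g.toFun x‖ ≤
    ‖conv (AdmissibleAlgebra.abs f.toFun) (AdmissibleAlgebra.abs g.toFun) x‖ := by
  have hs : Summable fun y => ‖f.toFun y‖ * ‖g.toFun (y⁻¹ * x)‖ := by
    refine Summable.of_nonneg_of_le (fun y => by positivity) (fun y => ?_)
      (f.summable_norm.mul_right (∑' a, ‖g.toFun a‖))
    exact mul_le_mul_of_nonneg_left (g.summable_norm.le_tsum _ (fun j _ => norm_nonneg _))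
      (norm_nonneg _)
  have : conv (AdmissibleAlgebra.abs f.toFun) (AdmissibleAlgebra.abs g.toFun) x
      = ((∑' y, ‖f.toFun y‖ * ‖g.toFun (y⁻¹ * x)‖ : ℝ) : ℂ) := by
    simp [conv, AdmissibleAlgebra.abs, Complex.ofReal_tsum]
  rw [this, Complex.norm_real, Real.norm_eq_abs]
  refine le_trans ?_ (le_abs_self _)
  exact tsum_of_norm_bounded hs.hasSum fun y => norm_mul_le _ _

theorem conv_mem (f g : VectorAlgebra L A) : conv f.toFun g.toFun ∈ vectorSubmodule L A := by
  refine (L.solid _ _ (L.conv_mem _ f.abs_mem _ g.abs_mem) fun x => ?_).1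
  rw [Complex.norm_real, norm_norm]
  exact norm_conv_le f g x

theorem invol_mem (f : VectorAlgebra L A) : invol f.toFun ∈ vectorSubmodule L A := by
  refine (L.solid _ _ (L.invol_mem _ f.abs_mem) fun x => ?_).1
  simp [invol, AdmissibleAlgebra.abs]

instance : Mul (VectorAlgebra L A) := ⟨fun f g => mk (conv f.toFun g.toFun) (conv_mem f g)⟩

instance : Star (VectorAlgebra L A) := ⟨fun f => mk (invol f.toFun) (invol_mem f)⟩

@[simp] theorem toFun_mul (f g : VectorAlgebra L A) :
    (f * g).toFun = conv f.toFun g.toFun := rfl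

@[simp] theorem toFun_star (f : VectorAlgebra L A) : (star f).toFun = invol f.toFun := rfl

theorem summable_mul (f g : VectorAlgebra L A) (x : G) :
    Summable fun y => f.toFun y * g.toFun (y⁻¹ * x) :=
  summable_conv f.summable_norm g.summable_norm x

instance : NonUnitalRing (VectorAlgebra L A) :=
  { (inferInstance : AddCommGroup (VectorAlgebra L A)),
    (inferInstance : Mul (VectorAlgebra L A)) with
    left_distrib := fun f g h => by
      ext x
      simp only [toFun_mul, toFun_add, conv, Pi.add_apply, mul_add]
      exact (summable_mul f g x).tsum_add (summable_mul f h x)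
    right_distrib := fun f g h => by
      ext x
      simp only [toFun_mul, toFun_add, conv, Pi.add_apply, add_mul]
      exact (summable_mul f h x).tsum_add (summable_mul g h x)
    zero_mul := fun f => by ext x; simp [conv]
    mul_zero := fun f => by ext x; simp [conv]
    mul_assoc := fun f g h => by
      ext1
      exact conv_assoc f.summable_norm g.summable_norm h.summable_norm }

instance : StarRing (VectorAlgebra L A) where
  star_involutive := fun f => by ext x; simp [invol]
  star_mul := fun f g => by
    ext x
    simp only [toFun_star, toFun_mul, invol, conv]
    rw [tsum_star, ← (Equiv.mulLeft x⁻¹).tsum_eq]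
    refine tsum_congr fun y => ?_
    simp [star_mul]
  star_add := fun f g => by ext x; simp [invol]

instance : StarModule ℂ (VectorAlgebra L A) where
  star_smul := fun c f => by ext x; simp [invol]

instance : IsScalarTower ℂ (VectorAlgebra L A) (VectorAlgebra L A) where
  smul_assoc := fun c f g => by
    ext x
    simp only [smul_eq_mul, toFun_mul, toFun_smul, conv, Pi.smul_apply, smul_mul_assoc]
    exact tsum_const_smul'' c

instance : SMulCommClass ℂ (VectorAlgebra L A) (VectorAlgebra L A) where
  smul_comm := fun c f g => by
    ext x
    simp only [smul_eq_mul, toFun_mul, toFun_smul, conv, Pi.smul_apply, mul_smul_comm]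
    exact (tsum_const_smul'' c).symm

instance : Norm (VectorAlgebra L A) := ⟨fun f => L.nrm fun x => ((‖f.toFun x‖ : ℝ) : ℂ)⟩

theorem norm_def (f : VectorAlgebra L A) : ‖f‖ = L.nrm (AdmissibleAlgebra.abs f.toFun) := rfl

theorem norm_le (f : VectorAlgebra L A) {k : G → ℂ} (hk : k ∈ L.carrier)
    (h : ∀ x, ‖f.toFun x‖ ≤ ‖k x‖) : ‖f‖ ≤ L.nrm k :=
  (L.solid _ k hk (by simpa [AdmissibleAlgebra.abs] using h)).2

theorem normCore : NormedSpace.Core ℂ (VectorAlgebra L A) where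
  norm_nonneg := fun f => L.nrm_nonneg f.abs_mem
  norm_smul := fun c f => by
    have : AdmissibleAlgebra.abs (c • f).toFun = (‖c‖ : ℂ) • AdmissibleAlgebra.abs f.toFun := by
      funext x; simp [AdmissibleAlgebra.abs, norm_smul]
    rw [norm_def, norm_def, this, L.nrm_smul _ _ f.abs_mem]
    simp
  norm_triangle := fun f g => by
    refine le_trans (norm_le _ (L.carrier.add_mem f.abs_mem g.abs_mem) fun x => ?_)
      (L.nrm_add_le _ f.abs_mem _ g.abs_mem)
    simp only [AdmissibleAlgebra.abs, Pi.add_apply, toFun_add, ← Complex.ofReal_add,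
      Complex.norm_real]
    exact (norm_add_le _ _).trans (le_abs_self _)
  norm_eq_zero_iff := fun f => by
    constructor
    · intro h
      obtain ⟨C, -, hC⟩ := L.exists_bound
      ext x
      have := hC _ f.abs_mem x
      rw [← norm_def, h, mul_zero, AdmissibleAlgebra.norm_abs] at this
      simpa using this
    · rintro rfl
      have : AdmissibleAlgebra.abs (0 : VectorAlgebra L A).toFun = 0 := by
        funext x; simp [AdmissibleAlgebra.abs]
      rw [norm_def, this, L.nrm_zero]

instance : NormedAddCommGroup (VectorAlgebra L A) := NormedAddCommGroup.ofCore normCore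

instance : NonUnitalNormedRing (VectorAlgebra L A) :=
  { (inferInstance : NormedAddCommGroup (VectorAlgebra L A)),
    (inferInstance : NonUnitalRing (VectorAlgebra L A)) with
    norm_mul_le := fun f g => by
      refine (norm_le _ (L.conv_mem _ f.abs_mem _ g.abs_mem) (norm_conv_le f g)).trans ?_
      exact L.nrm_conv_le _ f.abs_mem _ g.abs_mem }

instance : NormedSpace ℂ (VectorAlgebra L A) where
  norm_smul_le := fun c f => (normCore.norm_smul c f).le

instance : NormedStarGroup (VectorAlgebra L A) where
  norm_star_le := fun f => by
    refine (norm_le (star f) (L.invol_mem _ f.abs_mem) fun x => ?_).trans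
      (L.nrm_invol _ f.abs_mem).le
    simp [invol, AdmissibleAlgebra.abs]

theorem toFun_sum (u : ℕ → VectorAlgebra L A) (s : Finset ℕ) (x : G) :
    (∑ i ∈ s, u i).toFun x = ∑ i ∈ s, (u i).toFun x := by
  classical
  induction s using Finset.induction_on with
  | empty => simp
  | insert a s ha ih => simp [Finset.sum_insert ha, ih]

instance : CompleteSpace (VectorAlgebra L A) := by
  refine NormedAddCommGroup.completeSpace_of_summable_imp_tendsto fun u hu => ?_
  obtain ⟨k, hk, hsx, hkx, hlim⟩ := L.exists_sum (fun n => (u n).abs_mem) hu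
  simp only [AdmissibleAlgebra.norm_abs] at hsx
  have hkx' : ∀ x, k x = ((∑' n, ‖(u n).toFun x‖ : ℝ) : ℂ) := fun x => by
    rw [← (hkx x).tsum_eq, Complex.ofReal_tsum]; rfl
  have hmem : (fun x => ∑' n, (u n).toFun x) ∈ vectorSubmodule L A := by
    refine (L.solid _ k hk fun x => ?_).1
    rw [hkx', Complex.norm_real, Complex.norm_real, norm_norm, Real.norm_eq_abs]
    exact (tsum_of_norm_bounded (hsx x).hasSum fun n => le_rfl).trans (le_abs_self _)
  refine ⟨mk _ hmem, ?_⟩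
  rw [tendsto_iff_norm_sub_tendsto_zero]
  refine squeeze_zero (fun n => norm_nonneg _) (fun n => ?_) hlim
  rw [norm_sub_rev]
  refine norm_le _ (L.carrier.sub_mem hk (L.carrier.sum_mem fun i _ => (u i).abs_mem)) fun x => ?_
  have e1 : (k - ∑ i ∈ Finset.range n, AdmissibleAlgebra.abs (u i).toFun) x
      = ((∑' i, ‖(u (i + n)).toFun x‖ : ℝ) : ℂ) := by
    rw [Pi.sub_apply, hkx', ← (hsx x).sum_add_tsum_nat_add n]
    simp [AdmissibleAlgebra.abs, Finset.sum_apply]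
  rw [e1, Complex.norm_real, Real.norm_eq_abs, toFun_sub, Pi.sub_apply, toFun_sum]
  change ‖∑' i, (u i).toFun x - _‖ ≤ _
  rw [← (hsx x).of_norm.sum_add_tsum_nat_add n, add_sub_cancel_left]
  exact (tsum_of_norm_bounded ((summable_nat_add_iff n).2 (hsx x)).hasSum
    fun n => le_rfl).trans (le_abs_self _)

end VectorAlgebra

end Vector

/-- `G` is rigidly `𝓛`-symmetric: `𝓛(G; A)` is symmetric for every C*-algebra `A`,
unital or not. -/
def IsRigidlySymmetric {G : Type u} [Group G] (L : AdmissibleAlgebra G) : Prop :=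
  ∀ (A : Type u) [NonUnitalCStarAlgebra A], IsSymmetric (VectorAlgebra L A)

/-! ## Translation-invariant C*-subalgebras of `ℓ^∞(G)` and 2-cocycles -/

section Kernel

variable {G : Type u} [Group G]

/-- The action of `G` on `ℓ^∞(G)` by left translations: `(α_x φ)(y) = φ(x⁻¹y)`. -/
def translate (x : G) (φ : lp (fun _ : G => ℂ) ∞) : lp (fun _ : G => ℂ) ∞ :=
  ⟨fun y => φ (x⁻¹ * y), memℓp_infty ⟨‖φ‖, by
    rintro _ ⟨y, rfl⟩
    exact lp.norm_apply_le_norm ENNReal.top_ne_zero φ _⟩⟩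

@[simp] theorem translate_apply (x : G) (φ : lp (fun _ : G => ℂ) ∞) (y : G) :
    translate x φ y = φ (x⁻¹ * y) := rfl

/-- A unital C*-subalgebra of `ℓ^∞(G)` (containing the constant function `1`) which is
invariant under translations. -/
structure InvariantSubalgebra (G : Type u) [Group G] extends
    StarSubalgebra ℂ (lp (fun _ : G => ℂ) ∞) where
  isClosed : IsClosed (toStarSubalgebra : Set (lp (fun _ : G => ℂ) ∞))
  translate_mem : ∀ (x : G), ∀ φ ∈ toStarSubalgebra, translate x φ ∈ toStarSubalgebra

/-- A (normalized) 2-cocycle of `G` with values in the unitary group of the translation-invariant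
C*-algebra `𝒜`. The value `ω(x, y; z)` is `ω x y z`. -/
structure TwoCocycle (𝒜 : InvariantSubalgebra G) where
  toFun : G → G → lp (fun _ : G => ℂ) ∞
  mem : ∀ x y, toFun x y ∈ 𝒜.toStarSubalgebra
  unitary : ∀ x y, toFun x y ∈ unitary (lp (fun _ : G => ℂ) ∞)
  cocycle : ∀ x y z,
    toFun x y * toFun (x * y) z = translate x (toFun y z) * toFun x (y * z)
  right_one : ∀ x, toFun x 1 = 1
  one_left : ∀ x, toFun 1 x = 1

instance (𝒜 : InvariantSubalgebra G) :
    CoeFun (TwoCocycle 𝒜) (fun _ => G → G → lp (fun _ : G => ℂ) ∞) := ⟨TwoCocycle.toFun⟩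

namespace TwoCocycle

variable {𝒜 : InvariantSubalgebra G} (ω : TwoCocycle 𝒜)

theorem norm_apply (x y z : G) : ‖ω x y z‖ = 1 := by
  have h := congrArg (fun φ : lp (fun _ : G => ℂ) ∞ => φ z)
    (Unitary.star_mul_self_of_mem (ω.unitary x y))
  simp only [lp.infty_coeFn_mul, lp.star_apply, Pi.mul_apply, lp.infty_coeFn_one,
    Pi.one_apply] at h
  have h2 := congrArg norm h
  rw [norm_mul, norm_star, norm_one] at h2
  nlinarith [norm_nonneg (ω x y z)]

theorem cocycle_apply (x y z t : G) :
    ω x y t * ω (x * y) z t = ω y z (x⁻¹ * t) * ω x (y * z) t := by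
  simpa using congrArg (fun φ : lp (fun _ : G => ℂ) ∞ => φ t) (ω.cocycle x y z)

/-- The weight `ω(xz⁻¹, zy⁻¹; x)`. -/
def weight (x z y : G) : ℂ := ω (x * z⁻¹) (z * y⁻¹) x

theorem norm_weight (x z y : G) : ‖ω.weight x z y‖ = 1 := ω.norm_apply _ _ _

theorem weight_cocycle (x b a y : G) :
    ω.weight x b a * ω.weight x a y = ω.weight b a y * ω.weight x b y := by
  have h := ω.cocycle_apply (x * b⁻¹) (b * a⁻¹) (a * y⁻¹) x
  simpa [weight, mul_assoc] using h

theorem weight_left (x y : G) : ω.weight x x y = 1 := by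
  simp [weight, ω.one_left]

theorem weight_right (x y : G) : ω.weight x y y = 1 := by
  simp [weight, ω.right_one]

theorem weight_symm (x y : G) : ω.weight x y x = ω.weight y x y := by
  simpa [weight_left, weight_right] using ω.weight_cocycle x y x y

theorem weight_star (x y z : G) : ω.weight x y x * ω.weight y z x * ω.weight x z y
    = ω.weight x z x * ω.weight z y z := by
  have h1 := ω.weight_cocycle x z y x
  have h2 := ω.weight_cocycle z y z x
  rw [weight_left, mul_one] at h2
  rw [h2]
  linear_combination (ω.weight y z x) * h1

theorem weight_mul_conj (x z y : G) :
    ω.weight x z y * star (ω.weight x z y) = 1 := by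
  have h := Complex.mul_conj (ω.weight x z y)
  rw [Complex.normSq_eq_norm_sq, ω.norm_weight] at h
  simpa using h

end TwoCocycle

/-! ## The algebra of scalar twisted kernels -/

/-- The space of scalar kernels `K : G × G → ℂ` dominated by some `k ∈ 𝓛(G)`, i.e.
`|K(x, y)| ≤ |k(xy⁻¹)|`, and such that `z ↦ K(xz, yz)` belongs to `𝒜` for all `x, y`. -/
def kernelSubmodule (L : AdmissibleAlgebra G) (𝒜 : InvariantSubalgebra G) :
    Submodule ℂ (G → G → ℂ) where
  carrier := {K | (∃ k ∈ L.carrier, ∀ x y, ‖K x y‖ ≤ ‖k (x * y⁻¹)‖) ∧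
    ∀ x y, ∃ φ ∈ 𝒜.toStarSubalgebra, ∀ z, φ z = K (x * z) (y * z)}
  zero_mem' := ⟨⟨0, L.carrier.zero_mem, by simp⟩, fun x y => ⟨0, zero_mem _, fun z => rfl⟩⟩
  add_mem' := by
    rintro K M ⟨⟨k, hk, hK⟩, hK'⟩ ⟨⟨m, hm, hM⟩, hM'⟩
    refine ⟨⟨_, L.carrier.add_mem (L.abs_mem hk) (L.abs_mem hm), fun x y => ?_⟩, fun x y => ?_⟩
    · simp only [AdmissibleAlgebra.abs, Pi.add_apply, ← Complex.ofReal_add, Complex.norm_real]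
      exact (norm_add_le _ _).trans ((add_le_add (hK x y) (hM x y)).trans (le_abs_self _))
    · obtain ⟨φ, hφ, h1⟩ := hK' x y
      obtain ⟨ψ, hψ, h2⟩ := hM' x y
      exact ⟨φ + ψ, add_mem hφ hψ, fun z => by simp [h1, h2]⟩
  smul_mem' := by
    rintro c K ⟨⟨k, hk, hK⟩, hK'⟩
    refine ⟨⟨_, L.carrier.smul_mem c hk, fun x y => ?_⟩, fun x y => ?_⟩
    · simp only [Pi.smul_apply, smul_eq_mul, norm_mul]
      exact mul_le_mul_of_nonneg_left (hK x y) (norm_nonneg _)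
    · obtain ⟨φ, hφ, h1⟩ := hK' x y
      exact ⟨c • φ, 𝒜.toStarSubalgebra.smul_mem hφ c, fun z => by simp [h1]⟩

/-- The algebra `𝔎^{𝓛,𝒜}_ω(G × G)` of scalar twisted kernels, with composition
`(K • M)(x, y) = ∑ z, K(x, z) M(z, y) ω(xz⁻¹, zy⁻¹; x)`, involution
`K•(x, y) = conj ω(xy⁻¹, yx⁻¹; x) conj K(y, x)`, and the norm
`‖K‖ = inf {‖k‖_𝓛 | |K(x, y)| ≤ |k(xy⁻¹)| for all x, y}`. -/
def KernelAlgebra (L : AdmissibleAlgebra G) (𝒜 : InvariantSubalgebra G) (_ω : TwoCocycle 𝒜) :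
    Type u :=
  ↥(kernelSubmodule L 𝒜)

namespace KernelAlgebra

variable {L : AdmissibleAlgebra G} {𝒜 : InvariantSubalgebra G} {ω : TwoCocycle 𝒜}

instance : AddCommGroup (KernelAlgebra L 𝒜 ω) :=
  inferInstanceAs (AddCommGroup (kernelSubmodule L 𝒜))

instance : Module ℂ (KernelAlgebra L 𝒜 ω) := inferInstanceAs (Module ℂ (kernelSubmodule L 𝒜))

/-- An element of the algebra from its underlying kernel. -/
def mk (K : G → G → ℂ) (hK : K ∈ kernelSubmodule L 𝒜) : KernelAlgebra L 𝒜 ω := ⟨K, hK⟩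

/-- The kernel underlying an element of the algebra. -/
def toFun (K : KernelAlgebra L 𝒜 ω) : G → G → ℂ := K.1

@[ext] theorem ext {K M : KernelAlgebra L 𝒜 ω} (h : K.toFun = M.toFun) : K = M := Subtype.ext h

@[simp] theorem toFun_mk (K : G → G → ℂ) (hK : K ∈ kernelSubmodule L 𝒜) :
    (mk K hK : KernelAlgebra L 𝒜 ω).toFun = K := rfl
@[simp] theorem toFun_add (K M : KernelAlgebra L 𝒜 ω) : (K + M).toFun = K.toFun + M.toFun := rfl
@[simp] theorem toFun_zero : (0 : KernelAlgebra L 𝒜 ω).toFun = 0 := rfl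
@[simp] theorem toFun_neg (K : KernelAlgebra L 𝒜 ω) : (-K).toFun = -K.toFun := rfl
@[simp] theorem toFun_sub (K M : KernelAlgebra L 𝒜 ω) : (K - M).toFun = K.toFun - M.toFun := rfl
@[simp] theorem toFun_smul (c : ℂ) (K : KernelAlgebra L 𝒜 ω) :
    (c • K).toFun = c • K.toFun := rfl

/-- The composition of twisted kernels. -/
def comp (ω : TwoCocycle 𝒜) (K M : G → G → ℂ) : G → G → ℂ :=
  fun x y => ∑' z, K x z * M z y * ω (x * z⁻¹) (z * y⁻¹) x

/-- The involution of twisted kernels. -/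
def adj (ω : TwoCocycle 𝒜) (K : G → G → ℂ) : G → G → ℂ :=
  fun x y => star (ω (x * y⁻¹) (y * x⁻¹) x) * star (K y x)

/-- The unit kernel. -/
def unitKernel : G → G → ℂ := fun x y => Set.indicator {(1 : G)} (fun _ => (1 : ℂ)) (x * y⁻¹)

theorem comp_eq_wmul (K M : G → G → ℂ) : comp ω K M = wmul ω.weight K M := by
  funext x y
  refine tsum_congr fun z => ?_
  simp [TwoCocycle.weight, mul_comm]

theorem summable_comp {K M : G → G → ℂ} {k m : G → ℂ} (hk : k ∈ L.carrier) (hm : m ∈ L.carrier)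
    (hK : ∀ x y, ‖K x y‖ ≤ ‖k (x * y⁻¹)‖) (hM : ∀ x y, ‖M x y‖ ≤ ‖m (x * y⁻¹)‖) (x y : G) :
    Summable fun z => K x z * M z y * ω (x * z⁻¹) (z * y⁻¹) x := by
  refine (summable_wmul ω.norm_weight (fun x => norm_nonneg (k x)) (fun x => norm_nonneg (m x))
    (L.summable k hk) (L.summable m hm) hK hM x y).congr fun z => ?_
  simp [TwoCocycle.weight, mul_comm]

theorem norm_comp_le {K M : G → G → ℂ} {k m : G → ℂ} (hk : k ∈ L.carrier) (hm : m ∈ L.carrier)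
    (hK : ∀ x y, ‖K x y‖ ≤ ‖k (x * y⁻¹)‖) (hM : ∀ x y, ‖M x y‖ ≤ ‖m (x * y⁻¹)‖) (x y : G) :
    ‖comp ω K M x y‖ ≤
      ‖conv (AdmissibleAlgebra.abs k) (AdmissibleAlgebra.abs m) (x * y⁻¹)‖ := by
  rw [AdmissibleAlgebra.norm_conv_abs]
  have hs := summable_dom (fun x => norm_nonneg (k x)) (fun x => norm_nonneg (m x))
    (L.summable k hk) (L.summable m hm) x y
  have e : ∑' z, ‖k (x * z⁻¹)‖ * ‖m (z * y⁻¹)‖ = ∑' z, ‖k z‖ * ‖m (z⁻¹ * (x * y⁻¹))‖ := by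
    rw [← ((Equiv.inv G).trans (Equiv.mulLeft x)).tsum_eq
      (fun z => ‖k z‖ * ‖m (z⁻¹ * (x * y⁻¹))‖)]
    refine tsum_congr fun z => ?_
    simp [mul_assoc]
  rw [← e, comp_eq_wmul]
  exact tsum_of_norm_bounded hs.hasSum fun z =>
    norm_wmul_term (k := fun x => ‖k x‖) (l := fun x => ‖m x‖) ω.norm_weight hK hM x y z

theorem comp_mem {K M : G → G → ℂ} (hK : K ∈ kernelSubmodule L 𝒜)
    (hM : M ∈ kernelSubmodule L 𝒜) : comp ω K M ∈ kernelSubmodule L 𝒜 := by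
  obtain ⟨⟨k, hk, hK⟩, hK'⟩ := hK
  obtain ⟨⟨m, hm, hM⟩, hM'⟩ := hM
  refine ⟨⟨_, L.conv_abs_mem hk hm, norm_comp_le hk hm hK hM⟩, fun x y => ?_⟩
  choose φ hφ hφK using fun v => hK' x v
  choose ψ hψ hψM using fun v => hM' v y
  let T : G → lp (fun _ : G => ℂ) ∞ := fun v =>
    φ v * ψ v * translate x⁻¹ (ω (x * v⁻¹) (v * y⁻¹))
  have hTz : ∀ v z, T v z = K (x * z) (v * z) * M (v * z) (y * z)
      * ω (x * z * (v * z)⁻¹) (v * z * (y * z)⁻¹) (x * z) := by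
    intro v z
    simp [T, hφK, hψM, mul_assoc]
  have hTmem : ∀ v, T v ∈ 𝒜.toStarSubalgebra := fun v =>
    mul_mem (mul_mem (hφ v) (hψ v)) (𝒜.translate_mem _ _ (ω.mem _ _))
  have hTs : Summable T := by
    refine Summable.of_norm_bounded (summable_dom (fun x => norm_nonneg (k x))
      (fun x => norm_nonneg (m x)) (L.summable k hk) (L.summable m hm) x y) fun v => ?_
    refine lp.norm_le_of_forall_le (by positivity) fun z => ?_
    rw [hTz, norm_mul, norm_mul, ω.norm_apply, mul_one]
    have h1 := hK (x * z) (v * z)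
    have h2 := hM (v * z) (y * z)
    simp only [mul_inv_rev, mul_assoc, mul_inv_cancel_left] at h1 h2
    exact mul_le_mul h1 h2 (norm_nonneg _) (norm_nonneg _)
  refine ⟨∑' v, T v, 𝒜.isClosed.mem_of_tendsto hTs.hasSum
    (Filter.Eventually.of_forall fun s => sum_mem fun i _ => hTmem i), fun z => ?_⟩
  have hz : HasSum (fun v => T v z) ((∑' v, T v) z) :=
    hTs.hasSum.map (lp.evalCLM ℂ (fun _ : G => ℂ) ∞ z) (lp.evalCLM ℂ (fun _ : G => ℂ) ∞ z).continuous
  rw [← hz.tsum_eq]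
  unfold comp
  rw [← (Equiv.mulRight z).tsum_eq (fun v => K (x * z) v * M v (y * z)
      * ω (x * z * v⁻¹) (v * (y * z)⁻¹) (x * z))]
  exact tsum_congr fun v => hTz v z

theorem adj_mem {K : G → G → ℂ} (hK : K ∈ kernelSubmodule L 𝒜) :
    adj ω K ∈ kernelSubmodule L 𝒜 := by
  obtain ⟨⟨k, hk, hK⟩, hK'⟩ := hK
  refine ⟨⟨_, L.invol_mem k hk, fun x y => ?_⟩, fun x y => ?_⟩
  · simpa [adj, invol, ω.norm_apply] using hK y x
  · obtain ⟨φ, hφ, h⟩ := hK' y x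
    refine ⟨star (translate x⁻¹ (ω (x * y⁻¹) (y * x⁻¹))) * star φ,
      mul_mem (star_mem (𝒜.translate_mem _ _ (ω.mem _ _))) (star_mem hφ), fun z => ?_⟩
    simp [adj, h, mul_assoc]

theorem unitKernel_mem : (unitKernel : G → G → ℂ) ∈ kernelSubmodule L 𝒜 := by
  refine ⟨⟨_, L.one_mem, fun x y => le_rfl⟩, fun x y => ?_⟩
  refine ⟨(Set.indicator {(1 : G)} (fun _ => (1 : ℂ)) (x * y⁻¹)) • 1,
    𝒜.toStarSubalgebra.smul_mem (one_mem _) _, fun z => ?_⟩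
  simp [unitKernel, mul_assoc]

instance : Mul (KernelAlgebra L 𝒜 ω) := 
  ⟨fun K M => mk (comp ω K.toFun M.toFun) (comp_mem K.2 M.2)⟩

instance : Star (KernelAlgebra L 𝒜 ω) := ⟨fun K => mk (adj ω K.toFun) (adj_mem K.2)⟩

instance : One (KernelAlgebra L 𝒜 ω) := ⟨mk unitKernel unitKernel_mem⟩

@[simp] theorem toFun_mul (K M : KernelAlgebra L 𝒜 ω) :
    (K * M).toFun = comp ω K.toFun M.toFun := rfl
@[simp] theorem toFun_star (K : KernelAlgebra L 𝒜 ω) : (star K).toFun = adj ω K.toFun := rfl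
@[simp] theorem toFun_one : (1 : KernelAlgebra L 𝒜 ω).toFun = unitKernel := rfl

theorem exists_dom (K : KernelAlgebra L 𝒜 ω) :
    ∃ k ∈ L.carrier, ∀ x y, ‖K.toFun x y‖ ≤ ‖k (x * y⁻¹)‖ := K.2.1

theorem summable_mul (K M : KernelAlgebra L 𝒜 ω) (x y : G) :
    Summable fun z => K.toFun x z * M.toFun z y * ω (x * z⁻¹) (z * y⁻¹) x := by
  obtain ⟨k, hk, hK⟩ := K.exists_dom
  obtain ⟨m, hm, hM⟩ := M.exists_dom
  exact summable_comp hk hm hK hM x y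

theorem unitKernel_self (x : G) : unitKernel x x = 1 := by simp [unitKernel]

theorem unitKernel_ne {x y : G} (h : x ≠ y) : unitKernel x y = 0 := by
  have : x * y⁻¹ ≠ 1 := fun h' => h (mul_inv_eq_one.1 h')
  simp [unitKernel, this]

instance : Ring (KernelAlgebra L 𝒜 ω) :=
  { (inferInstance : AddCommGroup (KernelAlgebra L 𝒜 ω)),
    (inferInstance : Mul (KernelAlgebra L 𝒜 ω)),
    (inferInstance : One (KernelAlgebra L 𝒜 ω)) with
    left_distrib := fun K M N => by
      ext x y
      simp only [toFun_mul, toFun_add, comp, Pi.add_apply, mul_add, add_mul]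
      exact (summable_mul K M x y).tsum_add (summable_mul K N x y)
    right_distrib := fun K M N => by
      ext x y
      simp only [toFun_mul, toFun_add, comp, Pi.add_apply, add_mul]
      exact (summable_mul K N x y).tsum_add (summable_mul M N x y)
    zero_mul := fun K => by ext x y; simp [comp]
    mul_zero := fun K => by ext x y; simp [comp]
    mul_assoc := fun K M N => by
      obtain ⟨k, hk, hK⟩ := K.exists_dom
      obtain ⟨m, hm, hM⟩ := M.exists_dom
      obtain ⟨n, hn, hN⟩ := N.exists_dom
      apply ext
      simp only [toFun_mul, comp_eq_wmul]
      exact wmul_assoc ω.norm_weight ω.weight_cocycle (fun x => norm_nonneg (k x))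
        (fun x => norm_nonneg (m x)) (fun x => norm_nonneg (n x)) (L.summable k hk)
        (L.summable m hm) (L.summable n hn) hK hM hN
    one_mul := fun K => by
      ext x y
      simp only [toFun_mul, toFun_one, comp]
      rw [tsum_eq_single x fun z hz => by rw [unitKernel_ne hz.symm, zero_mul, zero_mul]]
      simp [unitKernel_self, ω.one_left]
    mul_one := fun K => by
      ext x y
      simp only [toFun_mul, toFun_one, comp]
      rw [tsum_eq_single y fun z hz => by rw [unitKernel_ne hz, mul_zero, zero_mul]]
      simp [unitKernel_self, ω.right_one]
    zsmul := (inferInstance : AddCommGroup (KernelAlgebra L 𝒜 ω)).zsmul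
    neg_add_cancel := neg_add_cancel }

theorem adj_eq (K : G → G → ℂ) (x y : G) :
    adj ω K x y = star (ω.weight x y x) * star (K y x) := rfl

instance : StarRing (KernelAlgebra L 𝒜 ω) where
  star_involutive := fun K => by
    ext x y
    simp only [toFun_star, adj_eq, star_mul', star_star]
    rw [ω.weight_symm y x, ← mul_assoc, mul_comm (star _), ω.weight_mul_conj, one_mul]
  star_mul := fun K M => by
    ext x y
    simp only [toFun_star, toFun_mul, adj_eq, comp_eq_wmul, wmul]
    rw [tsum_star, ← tsum_mul_left]
    refine tsum_congr fun z => ?_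
    have h := congrArg star (ω.weight_star x y z)
    simp only [star_mul'] at h
    have h' := ω.weight_mul_conj x z y
    simp only [smul_eq_mul, star_mul']
    linear_combination (star (K.toFun y z) * star (M.toFun z x) * ω.weight x z y) * h
      - (star (ω.weight x y x) * star (ω.weight y z x) * star (K.toFun y z)
        * star (M.toFun z x)) * h'
  star_add := fun K M => by ext x y; simp [adj_eq, mul_add]

instance : StarModule ℂ (KernelAlgebra L 𝒜 ω) where
  star_smul := fun c K => by ext x y; simp [adj_eq, mul_left_comm]

instance : Algebra ℂ (KernelAlgebra L 𝒜 ω) :=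
  Algebra.ofModule
    (fun c K M => by
      ext x y
      simp only [toFun_mul, toFun_smul, comp, Pi.smul_apply, smul_eq_mul, mul_assoc]
      exact tsum_mul_left)
    (fun c K M => by
      ext x y
      simp only [toFun_mul, toFun_smul, comp, Pi.smul_apply, smul_eq_mul]
      rw [← tsum_mul_left]
      exact tsum_congr fun z => by ring)

instance : Norm (KernelAlgebra L 𝒜 ω) :=
  ⟨fun K => sInf {r | ∃ k ∈ L.carrier, (∀ x y, ‖K.toFun x y‖ ≤ ‖k (x * y⁻¹)‖) ∧ r = L.nrm k}⟩

theorem norm_def (K : KernelAlgebra L 𝒜 ω) : ‖K‖ =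
    sInf {r | ∃ k ∈ L.carrier, (∀ x y, ‖K.toFun x y‖ ≤ ‖k (x * y⁻¹)‖) ∧ r = L.nrm k} := rfl

theorem norm_le (K : KernelAlgebra L 𝒜 ω) {k : G → ℂ} (hk : k ∈ L.carrier)
    (h : ∀ x y, ‖K.toFun x y‖ ≤ ‖k (x * y⁻¹)‖) : ‖K‖ ≤ L.nrm k := by
  rw [norm_def]
  refine csInf_le ⟨0, ?_⟩ ⟨k, hk, h, rfl⟩
  rintro _ ⟨k, hk, -, rfl⟩
  exact L.nrm_nonneg hk

theorem exists_dom_lt (K : KernelAlgebra L 𝒜 ω) {ε : ℝ} (hε : 0 < ε) :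
    ∃ k ∈ L.carrier, (∀ x y, ‖K.toFun x y‖ ≤ ‖k (x * y⁻¹)‖) ∧ L.nrm k < ‖K‖ + ε := by
  obtain ⟨k, hk, hK⟩ := K.exists_dom
  have hne : {r | ∃ k ∈ L.carrier, (∀ x y, ‖K.toFun x y‖ ≤ ‖k (x * y⁻¹)‖) ∧ r = L.nrm k}.Nonempty :=
    ⟨L.nrm k, k, hk, hK, rfl⟩
  obtain ⟨_, ⟨k, hk, h, rfl⟩, hlt⟩ := exists_lt_of_csInf_lt (b := ‖K‖ + ε) hne
    (by rw [← norm_def]; linarith)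
  exact ⟨k, hk, h, hlt⟩

theorem norm_nonneg' (K : KernelAlgebra L 𝒜 ω) : 0 ≤ ‖K‖ := by
  refine Real.sInf_nonneg ?_
  rintro _ ⟨k, hk, -, rfl⟩
  exact L.nrm_nonneg hk

theorem norm_smul_le' (c : ℂ) (K : KernelAlgebra L 𝒜 ω) : ‖c • K‖ ≤ ‖c‖ * ‖K‖ := by
  refine le_of_forall_pos_le_add fun ε hε => ?_
  have hc : 0 < ‖c‖ + 1 := by positivity
  obtain ⟨k, hk, h, hlt⟩ := K.exists_dom_lt (div_pos hε hc)
  refine (norm_le _ (L.carrier.smul_mem c hk) fun x y => ?_).trans ?_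
  · simp only [toFun_smul, Pi.smul_apply, norm_smul]
    exact mul_le_mul_of_nonneg_left (h x y) (norm_nonneg _)
  · rw [L.nrm_smul c k hk]
    have h1 : ‖c‖ * (ε / (‖c‖ + 1)) ≤ ε := by
      rw [mul_div_assoc', div_le_iff₀ hc]
      nlinarith [norm_nonneg c]
    nlinarith [norm_nonneg c]

theorem normCore : NormedSpace.Core ℂ (KernelAlgebra L 𝒜 ω) where
  norm_nonneg := norm_nonneg'
  norm_smul := fun c K => by
    refine le_antisymm (norm_smul_le' c K) ?_
    rcases eq_or_ne c 0 with rfl | hc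
    · simpa using norm_nonneg' _
    · have h := norm_smul_le' c⁻¹ (c • K)
      rw [smul_smul, inv_mul_cancel₀ hc, one_smul, norm_inv] at h
      have hc' : 0 < ‖c‖ := norm_pos_iff.2 hc
      rwa [inv_mul_eq_div, le_div_iff₀ hc', mul_comm] at h
  norm_triangle := fun K M => by
    refine le_of_forall_pos_le_add fun ε hε => ?_
    obtain ⟨k, hk, hK, hkl⟩ := K.exists_dom_lt (half_pos hε)
    obtain ⟨m, hm, hM, hml⟩ := M.exists_dom_lt (half_pos hε)
    refine (norm_le _ (L.carrier.add_mem (L.abs_mem hk) (L.abs_mem hm)) fun x y => ?_).trans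
      ((L.nrm_add_le _ (L.abs_mem hk) _ (L.abs_mem hm)).trans ?_)
    · simp only [AdmissibleAlgebra.abs, toFun_add, Pi.add_apply, ← Complex.ofReal_add,
        Complex.norm_real]
      exact (norm_add_le _ _).trans ((add_le_add (hK x y) (hM x y)).trans (le_abs_self _))
    · rw [L.nrm_abs hk, L.nrm_abs hm]
      linarith
  norm_eq_zero_iff := fun K => by
    constructor
    · intro h
      obtain ⟨C, hC0, hC⟩ := L.exists_bound
      ext x y
      have : ‖K.toFun x y‖ ≤ 0 := by
        refine le_of_forall_pos_le_add fun ε hε => ?_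
        obtain ⟨k, hk, hK, hkl⟩ := K.exists_dom_lt (ε := ε / (C + 1)) (by positivity)
        rw [h, zero_add] at hkl
        refine ((hK x y).trans (hC k hk _)).trans ?_
        have h1 : (C + 1) * (ε / (C + 1)) = ε := by field_simp
        nlinarith [L.nrm_nonneg hk]
      simpa using this
    · rintro rfl
      refine le_antisymm ?_ (norm_nonneg' _)
      have := norm_le (0 : KernelAlgebra L 𝒜 ω) L.carrier.zero_mem (by simp)
      rwa [L.nrm_zero] at this

instance : NormedAddCommGroup (KernelAlgebra L 𝒜 ω) := NormedAddCommGroup.ofCore normCore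

instance : NormedRing (KernelAlgebra L 𝒜 ω) :=
  { (inferInstance : NormedAddCommGroup (KernelAlgebra L 𝒜 ω)),
    (inferInstance : Ring (KernelAlgebra L 𝒜 ω)) with
    norm_mul_le := fun K M => by
      refine le_of_forall_pos_le_add fun ε hε => ?_
      have hc : 0 < ‖K‖ + ‖M‖ + 1 := by positivity
      obtain ⟨δ, hδ, hδ1, hδε⟩ : ∃ δ : ℝ, 0 < δ ∧ δ ≤ 1 ∧ δ * (‖K‖ + ‖M‖ + 1) ≤ ε := by
        refine ⟨min 1 (ε / (‖K‖ + ‖M‖ + 1)), lt_min one_pos (by positivity), min_le_left _ _, ?_⟩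
        exact (mul_le_mul_of_nonneg_right (min_le_right _ _) hc.le).trans
          (div_mul_cancel₀ _ hc.ne').le
      obtain ⟨k, hk, hK, hkl⟩ := K.exists_dom_lt hδ
      obtain ⟨m, hm, hM, hml⟩ := M.exists_dom_lt hδ
      refine (norm_le (K * M) (L.conv_abs_mem hk hm) (norm_comp_le hk hm hK hM)).trans
        ((L.nrm_conv_abs_le hk hm).trans ?_)
      refine (mul_le_mul hkl.le hml.le (L.nrm_nonneg hm) (by positivity)).trans ?_
      nlinarith }

instance : NormedAlgebra ℂ (KernelAlgebra L 𝒜 ω) where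
  norm_smul_le := norm_smul_le'

instance : NormedStarGroup (KernelAlgebra L 𝒜 ω) where
  norm_star_le := fun K => by
    refine le_of_forall_pos_le_add fun ε hε => ?_
    obtain ⟨k, hk, hK, hkl⟩ := K.exists_dom_lt hε
    refine (norm_le (star K) (L.invol_mem k hk) fun x y => ?_).trans
      ((L.nrm_invol k hk).le.trans hkl.le)
    simpa [adj, invol, ω.norm_apply] using hK y x

theorem toFun_sum (u : ℕ → KernelAlgebra L 𝒜 ω) (s : Finset ℕ) (x y : G) :
    (∑ i ∈ s, u i).toFun x y = ∑ i ∈ s, (u i).toFun x y := by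
  classical
  induction s using Finset.induction_on with
  | empty => simp
  | insert a s ha ih => simp [Finset.sum_insert ha, ih]

instance : CompleteSpace (KernelAlgebra L 𝒜 ω) := by
  refine NormedAddCommGroup.completeSpace_of_summable_imp_tendsto fun u hu => ?_
  choose κ hκ hdom hlt using fun n => (u n).exists_dom_lt (ε := (1 / 2) ^ n) (by positivity)
  have hnrm : Summable fun n => L.nrm (AdmissibleAlgebra.abs (κ n)) := by
    refine Summable.of_nonneg_of_le (fun n => L.nrm_nonneg (L.abs_mem (hκ n))) (fun n => ?_)
      (hu.add summable_geometric_two)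
    rw [L.nrm_abs (hκ n)]
    exact (hlt n).le
  obtain ⟨k, hk, hsx, hkx, hlim⟩ := L.exists_sum (fun n => L.abs_mem (hκ n)) hnrm
  simp only [AdmissibleAlgebra.norm_abs] at hsx
  have hkx' : ∀ x, k x = ((∑' n, ‖κ n x‖ : ℝ) : ℂ) := fun x => by
    rw [← (hkx x).tsum_eq, Complex.ofReal_tsum]; rfl
  have hsu : ∀ x y, Summable fun n => ‖(u n).toFun x y‖ := fun x y =>
    Summable.of_nonneg_of_le (fun n => norm_nonneg _) (fun n => hdom n x y) (hsx (x * y⁻¹))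
  have hmem : (fun x y => ∑' n, (u n).toFun x y) ∈ kernelSubmodule L 𝒜 := by
    refine ⟨⟨k, hk, fun x y => ?_⟩, fun x y => ?_⟩
    · rw [hkx', Complex.norm_real, Real.norm_eq_abs]
      exact (tsum_of_norm_bounded (hsx (x * y⁻¹)).hasSum fun n => hdom n x y).trans
        (le_abs_self _)
    · choose T hTmem hTz using fun n => (u n).2.2 x y
      have hTs : Summable T := by
        refine Summable.of_norm_bounded (hsx (x * y⁻¹)) fun n => ?_
        refine lp.norm_le_of_forall_le (norm_nonneg _) fun z => ?_
        have h1 := hdom n (x * z) (y * z)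
        simp only [mul_inv_rev, mul_assoc, mul_inv_cancel_left] at h1
        rw [hTz]
        exact h1
      refine ⟨∑' n, T n, 𝒜.isClosed.mem_of_tendsto hTs.hasSum
        (Filter.Eventually.of_forall fun s => sum_mem fun i _ => hTmem i), fun z => ?_⟩
      have hz : HasSum (fun n => T n z) ((∑' n, T n) z) :=
        hTs.hasSum.map (lp.evalCLM ℂ (fun _ : G => ℂ) ∞ z)
          (lp.evalCLM ℂ (fun _ : G => ℂ) ∞ z).continuous
      rw [← hz.tsum_eq]
      exact tsum_congr fun n => hTz n z
  refine ⟨mk _ hmem, ?_⟩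
  rw [tendsto_iff_norm_sub_tendsto_zero]
  refine squeeze_zero (fun n => norm_nonneg _) (fun n => ?_) hlim
  rw [norm_sub_rev]
  refine norm_le _ (L.carrier.sub_mem hk
    (L.carrier.sum_mem fun i _ => L.abs_mem (hκ i))) fun x y => ?_
  have e1 : (k - ∑ i ∈ Finset.range n, AdmissibleAlgebra.abs (κ i)) (x * y⁻¹)
      = ((∑' i, ‖κ (i + n) (x * y⁻¹)‖ : ℝ) : ℂ) := by
    rw [Pi.sub_apply, hkx', ← (hsx (x * y⁻¹)).sum_add_tsum_nat_add n]
    simp [AdmissibleAlgebra.abs, Finset.sum_apply]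
  rw [e1, Complex.norm_real, Real.norm_eq_abs, toFun_sub, Pi.sub_apply, Pi.sub_apply, toFun_sum]
  change ‖∑' i, (u i).toFun x y - _‖ ≤ _
  rw [← (hsu x y).of_norm.sum_add_tsum_nat_add n, add_sub_cancel_left]
  exact (tsum_of_norm_bounded ((summable_nat_add_iff n).2 (hsx (x * y⁻¹))).hasSum
    fun i => hdom (i + n) x y).trans (le_abs_self _)

end KernelAlgebra

end Kernel

end TwistedKernel

end

noncomputable section

namespace TwistedKernel

/-! ## Spectra in closed subalgebras -/

/-! The kernel algebra embeds isometrically, as a unital `*`-algebra, in `𝓛(G; B(ℓ²(G)))`, and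
symmetry descends along such an embedding.

For the embedding, cut a kernel `K` into its diagonals `{(x, y) | xy⁻¹ = g}`. The part of the matrix
on the `g`-th diagonal is a bounded operator on `ℓ²(G)`, a multiplication operator times translation
by `g`, and `K` becomes the family of these operators indexed by `g`. The translations sit inside
the operators, so the action of `G` no longer appears in the product: composition of kernels becomes
plain convolution with coefficients in one C*-algebra, which is what rigid symmetry covers.

The twist is removed beforehand. With values in `ℓ^∞(G)` the cocycle is a coboundary: `γ(x, y) =
ω(xy⁻¹, y; x)` has modulus one and satisfies `γ(x, z) γ(z, y) = ω(xz⁻¹, zy⁻¹; x) γ(x, y)`, so `K ↦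
Kγ` turns the twisted composition into the ordinary one (`gauge_mul_gauge`, `toVector_mul`,
`toVector_star`). The diagonals of `γ` need not lie in `𝒜`; this is harmless, since the target has
all of `B(ℓ²(G))` as coefficients. The norm of the `g`-th operator is the supremum of `|K|` on the
`g`-th diagonal, the least value at `g` of a function dominating `K`, so solidity gives the isometry
(`norm_toVector`).

For the descent, the image is complete, hence closed. Passing to a closed unital subalgebra can
enlarge a spectrum only by filling bounded components of its complement, and a subset of `[0, ∞)`
leaves none (`spectrum_nonneg_of_isometry`). -/

theorem isPreconnected_compl_of_subset_nonneg {s : Set ℂ} (hs : ∀ z ∈ s, 0 ≤ z) :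
    IsPreconnected sᶜ := by
  -- `ℂ` minus `[0, ∞)` is the reflected slit plane. It is connected, and `sᶜ` lies between it and
  -- its closure, which is all of `ℂ`.
  have hU : IsPreconnected ((fun z : ℂ => -z) ⁻¹' Complex.slitPlane) := by
    rw [← Set.image_eq_preimage_of_inverse neg_neg neg_neg]
    exact Complex.starConvex_one_slitPlane.isPathConnected Complex.one_mem_slitPlane
      |>.isConnected.isPreconnected.image _ (by fun_prop)
  refine hU.subset_closure (fun z hz hz' => ?_) fun z _ => ?_
  · have := hs z hz'
    rw [Set.mem_preimage, Complex.mem_slitPlane_iff_not_le_zero] at hz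
    exact hz (by simpa using this)
  · by_cases h : (-z) ∈ Complex.slitPlane
    · exact subset_closure h
    · rw [Complex.mem_slitPlane_iff_not_le_zero, not_not, neg_nonpos] at h
      -- A point of `[0, ∞)` is a limit of points of the open upper half-plane, which avoids the
      -- removed ray.
      refine closure_mono (s := {w : ℂ | 0 < w.im}) (fun w hw => ?_) ?_
      · exact Or.inr (by simpa using (ne_of_gt hw))
      · rw [Complex.closure_setOfPred_lt_im]
        exact (Complex.le_def.1 h).2.le

/-- An isometric unital homomorphism of Banach algebras preserves the spectrum of an element
whose image has nonnegative spectrum. -/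
theorem spectrum_nonneg_of_isometry {A B : Type*} [NormedRing A] [NormedAlgebra ℂ A]
    [CompleteSpace A] [NormedRing B] [NormedAlgebra ℂ B] [CompleteSpace B] (φ : A →ₐ[ℂ] B)
    (hφ : Isometry φ) (a : A) (h : ∀ z ∈ spectrum ℂ (φ a), 0 ≤ z) : ∀ z ∈ spectrum ℂ a, 0 ≤ z := by
  -- Completeness of `A` enters here: an isometric image of a complete space is closed.
  have hcl : IsClosed (φ.range : Set B) := by
    rw [AlgHom.coe_range]
    exact hφ.isClosedEmbedding.isClosed_range
  let e := AlgEquiv.ofInjective φ hφ.injective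
  have he : spectrum ℂ (e a) = spectrum ℂ (φ a) :=
    haveI := hcl
    Subalgebra.spectrum_eq_of_isPreconnected_compl φ.range (e a)
      (isPreconnected_compl_of_subset_nonneg h)
  rw [← AlgEquiv.spectrum_eq e, he]
  exact h

/-! ## The unit of `𝓛(G; B)` for unital `B` -/

section Unital

variable {G : Type u} [Group G]

namespace VectorAlgebra

variable {L : AdmissibleAlgebra G} {B : Type*} [CStarAlgebra B]

/-- The unit mass at the identity of the group. -/
def delta (G : Type u) [Group G] (B : Type*) [CStarAlgebra B] : G → B :=
  Set.indicator {(1 : G)} (fun _ => (1 : B))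

theorem delta_mem : delta G B ∈ vectorSubmodule L B := by
  -- The factor `‖1‖` is kept because `‖1‖ = 1` fails when `B` is trivial.
  refine (L.solid _ _ (L.carrier.smul_mem (‖(1 : B)‖ : ℂ) L.one_mem) fun x => ?_).1
  by_cases hx : x = 1 <;> simp [delta, hx]

instance : One (VectorAlgebra L B) := ⟨mk (delta G B) delta_mem⟩

@[simp] theorem toFun_one : (1 : VectorAlgebra L B).toFun = delta G B := rfl

/-- Extends the existing non-unital structure, so that the quasispectrum in the symmetry hypothesis
and the spectrum used for permanence refer to the same product. -/
instance : NormedRing (VectorAlgebra L B) :=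
  { (inferInstance : NonUnitalNormedRing (VectorAlgebra L B)),
    (inferInstance : One (VectorAlgebra L B)) with
    one_mul := fun f => by
      ext x
      simp only [toFun_mul, toFun_one, conv]
      rw [tsum_eq_single 1 fun z hz => by simp [delta, hz]]
      simp [delta]
    mul_one := fun f => by
      ext x
      simp only [toFun_mul, toFun_one, conv]
      rw [tsum_eq_single x fun z hz => by
        have : z⁻¹ * x ≠ 1 := fun h => hz (inv_mul_eq_one.1 h)
        simp [delta, this]]
      simp [delta] }

instance : NormedAlgebra ℂ (VectorAlgebra L B) :=
  { Algebra.ofModule (fun c f g => smul_mul_assoc c f g) (fun c f g => mul_smul_comm c f g) with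
    norm_smul_le := fun c f => norm_smul_le c f }

end VectorAlgebra

end Unital

/-! ## Weighted translations of `ℓ²(G)` -/

section Shift

variable {G : Type u} [Group G]

/-- Pointwise `|φ| ≤ ‖φ‖`, and translation preserves the `ℓ²`-norm. The first half puts the image
vector in `ℓ²(G)`, the second bounds the operator. -/
theorem summable_weightedShift (φ : lp (fun _ : G => ℂ) ∞) (g : G) (ξ : lp (fun _ : G => ℂ) 2) :
    Summable (fun x => ‖φ x * ξ (g⁻¹ * x)‖ ^ (2 : ℝ≥0∞).toReal) ∧
      ∑' x, ‖φ x * ξ (g⁻¹ * x)‖ ^ (2 : ℝ≥0∞).toReal ≤ (‖φ‖ * ‖ξ‖) ^ (2 : ℝ≥0∞).toReal := by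
  have hp : 0 < (2 : ℝ≥0∞).toReal := by simp
  have h1 : HasSum (fun x => ‖ξ (g⁻¹ * x)‖ ^ (2 : ℝ≥0∞).toReal) (‖ξ‖ ^ (2 : ℝ≥0∞).toReal) := by
    rw [lp.norm_rpow_eq_tsum hp]
    exact (Equiv.mulLeft g⁻¹).hasSum_iff.2 ((lp.memℓp ξ).summable hp).hasSum
  have h2 := h1.mul_left (‖φ‖ ^ (2 : ℝ≥0∞).toReal)
  have h3 : ∀ x, ‖φ x * ξ (g⁻¹ * x)‖ ^ (2 : ℝ≥0∞).toReal ≤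
      ‖φ‖ ^ (2 : ℝ≥0∞).toReal * ‖ξ (g⁻¹ * x)‖ ^ (2 : ℝ≥0∞).toReal := fun x => by
    rw [← Real.mul_rpow (norm_nonneg _) (norm_nonneg _), norm_mul]
    gcongr
    exact lp.norm_apply_le_norm ENNReal.top_ne_zero φ _
  have h4 := Summable.of_nonneg_of_le (fun x => by positivity) h3 h2.summable
  refine ⟨h4, ?_⟩
  rw [Real.mul_rpow (norm_nonneg _) (norm_nonneg _), ← h2.tsum_eq]
  exact h4.tsum_le_tsum h3 h2.summable

/-- The operator `(Tξ)(x) = φ(x) ξ(g⁻¹x)` on `ℓ²(G)`. -/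
def weightedShift (φ : lp (fun _ : G => ℂ) ∞) (g : G) :
    lp (fun _ : G => ℂ) 2 →L[ℂ] lp (fun _ : G => ℂ) 2 :=
  LinearMap.mkContinuous
    { toFun := fun ξ => ⟨fun x => φ x * ξ (g⁻¹ * x), memℓp_gen (summable_weightedShift φ g ξ).1⟩
      map_add' := fun ξ η => by ext x; exact mul_add _ _ _
      map_smul' := fun c ξ => by ext x; exact mul_left_comm _ _ _ } ‖φ‖
    fun ξ => lp.norm_le_of_tsum_le (by simp) (by positivity) (summable_weightedShift φ g ξ).2

@[simp] theorem weightedShift_apply (φ : lp (fun _ : G => ℂ) ∞) (g : G)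
    (ξ : lp (fun _ : G => ℂ) 2) (x : G) : weightedShift φ g ξ x = φ x * ξ (g⁻¹ * x) := rfl

theorem norm_weightedShift_le (φ : lp (fun _ : G => ℂ) ∞) (g : G) : ‖weightedShift φ g‖ ≤ ‖φ‖ :=
  LinearMap.mkContinuous_norm_le _ (norm_nonneg _) _

theorem norm_apply_le_weightedShift (φ : lp (fun _ : G => ℂ) ∞) (g x : G) :
    ‖φ x‖ ≤ ‖weightedShift φ g‖ := by
  classical
  -- The unit vector at `g⁻¹x` is sent to `φ(x)` times the unit vector at `x`.
  have h1 := (weightedShift φ g).le_opNorm (lp.single 2 (g⁻¹ * x) (1 : ℂ))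
  rw [lp.norm_single (by simp), norm_one, mul_one] at h1
  refine le_trans ?_ ((lp.norm_apply_le_norm two_ne_zero _ x).trans h1)
  simp

theorem weightedShift_add (φ ψ : lp (fun _ : G => ℂ) ∞) (g : G) :
    weightedShift (φ + ψ) g = weightedShift φ g + weightedShift ψ g := by
  ext ξ x
  exact add_mul _ _ _

theorem weightedShift_smul (c : ℂ) (φ : lp (fun _ : G => ℂ) ∞) (g : G) :
    weightedShift (c • φ) g = c • weightedShift φ g := by
  ext ξ x
  exact mul_assoc _ _ _

theorem star_weightedShift (φ : lp (fun _ : G => ℂ) ∞) (g : G) :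
    star (weightedShift φ g) = weightedShift (translate g⁻¹ (star φ)) g⁻¹ := by
  rw [ContinuousLinearMap.star_eq_adjoint]
  symm
  rw [ContinuousLinearMap.eq_adjoint_iff]
  intro ξ η
  -- The two inner products are the same sum after the substitution `x ↦ g⁻¹x`.
  rw [lp.inner_eq_tsum, lp.inner_eq_tsum, ← (Equiv.mulLeft g⁻¹).tsum_eq]
  refine tsum_congr fun x => ?_
  simp
  ring

end Shift

/-! ### Trivializing the cocycle over `ℓ^∞(G)`. -/

namespace TwoCocycle

variable {G : Type u} [Group G] {𝒜 : InvariantSubalgebra G} (ω : TwoCocycle 𝒜)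

/-- A scalar function on `G × G` whose coboundary is the weight of the cocycle. -/
def gauge (x y : G) : ℂ := ω.weight x y 1

theorem norm_gauge (x y : G) : ‖ω.gauge x y‖ = 1 := ω.norm_weight _ _ _

/-- The cocycle identity for the weights with the last point taken to be `1`. Multiplying kernels by
the gauge therefore absorbs the weight in the composition. -/
theorem gauge_mul_gauge (x z y : G) :
    ω.gauge x z * ω.gauge z y = ω.weight x z y * ω.gauge x y := by
  rw [gauge, gauge, gauge, mul_comm, ω.weight_cocycle]

theorem gauge_self (x : G) : ω.gauge x x = 1 := ω.weight_left _ _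

/-- The coboundary relation around the loop `x, y, x` writes the weight as `γ(x, y) γ(y, x)`, and
`γ(x, y)` has modulus one. This makes multiplication by the gauge compatible with the involutions.
-/
theorem star_weight_mul_gauge (x y : G) :
    star (ω.weight x y x) * ω.gauge x y = star (ω.gauge y x) := by
  have h := ω.gauge_mul_gauge x y x
  rw [gauge_self, mul_one] at h
  rw [← h, star_mul']
  have h'' := ω.weight_mul_conj x y 1
  simp only [gauge] at *
  linear_combination (star (ω.weight y x 1)) * h''

end TwoCocycle

/-! ## The embedding of the kernel algebra -/

namespace KernelAlgebra

variable {G : Type u} [Group G] {L : AdmissibleAlgebra G} {𝒜 : InvariantSubalgebra G}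
  {ω : TwoCocycle 𝒜}

theorem norm_diagonal_le (K : KernelAlgebra L 𝒜 ω) {k : G → ℂ}
    (h : ∀ x y, ‖K.toFun x y‖ ≤ ‖k (x * y⁻¹)‖) (g x : G) :
    ‖K.toFun x (g⁻¹ * x) * ω.gauge x (g⁻¹ * x)‖ ≤ ‖k g‖ := by
  rw [norm_mul, ω.norm_gauge, mul_one]
  simpa using h x (g⁻¹ * x)

/-- The `g`-th diagonal `x ↦ K(x, g⁻¹x)` of a kernel, made untwisted by the gauge. -/
def diagonal (K : KernelAlgebra L 𝒜 ω) (g : G) : lp (fun _ : G => ℂ) ∞ :=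
  ⟨fun x => K.toFun x (g⁻¹ * x) * ω.gauge x (g⁻¹ * x), memℓp_infty (by
    obtain ⟨k, -, h⟩ := K.exists_dom
    refine ⟨‖k g‖, ?_⟩
    rintro _ ⟨x, rfl⟩
    exact K.norm_diagonal_le h g x)⟩

@[simp] theorem diagonal_apply (K : KernelAlgebra L 𝒜 ω) (g x : G) :
    K.diagonal g x = K.toFun x (g⁻¹ * x) * ω.gauge x (g⁻¹ * x) := rfl

theorem norm_weightedShift_diagonal_le (K : KernelAlgebra L 𝒜 ω) {k : G → ℂ}
    (h : ∀ x y, ‖K.toFun x y‖ ≤ ‖k (x * y⁻¹)‖) (g : G) :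
    ‖weightedShift (K.diagonal g) g‖ ≤ ‖k g‖ :=
  (norm_weightedShift_le _ _).trans
    (lp.norm_le_of_forall_le (norm_nonneg _) (K.norm_diagonal_le h g))

theorem norm_le_weightedShift_diagonal (K : KernelAlgebra L 𝒜 ω) (x y : G) :
    ‖K.toFun x y‖ ≤ ‖weightedShift (K.diagonal (x * y⁻¹)) (x * y⁻¹)‖ := by
  have h := norm_apply_le_weightedShift (K.diagonal (x * y⁻¹)) (x * y⁻¹) x
  simpa [ω.norm_gauge] using h

/-- The element of `𝓛(G; B(ℓ²(G)))` made of the diagonals of a kernel. -/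
def toVector (K : KernelAlgebra L 𝒜 ω) :
    VectorAlgebra L (lp (fun _ : G => ℂ) 2 →L[ℂ] lp (fun _ : G => ℂ) 2) :=
  VectorAlgebra.mk (fun g => weightedShift (K.diagonal g) g) (by
    obtain ⟨k, hk, h⟩ := K.exists_dom
    refine (L.solid _ k hk fun g => ?_).1
    rw [Complex.norm_real, norm_norm]
    exact K.norm_weightedShift_diagonal_le h g)

@[simp] theorem toFun_toVector (K : KernelAlgebra L 𝒜 ω) (g : G) :
    K.toVector.toFun g = weightedShift (K.diagonal g) g := rfl

/-- Any `k` dominating `K` dominates the operator norms of the diagonals, and the function of these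
operator norms itself dominates `K`. So the infimum defining `‖K‖` is attained there. -/
theorem norm_toVector (K : KernelAlgebra L 𝒜 ω) : ‖K.toVector‖ = ‖K‖ := by
  refine le_antisymm (le_of_forall_pos_le_add fun ε hε => ?_) ?_
  · obtain ⟨k, hk, h, hlt⟩ := K.exists_dom_lt hε
    exact (VectorAlgebra.norm_le _ hk (K.norm_weightedShift_diagonal_le h)).trans hlt.le
  · rw [VectorAlgebra.norm_def]
    refine norm_le K K.toVector.abs_mem fun x y => ?_
    rw [AdmissibleAlgebra.norm_abs]
    exact K.norm_le_weightedShift_diagonal x y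

theorem toVector_add (K M : KernelAlgebra L 𝒜 ω) :
    (K + M).toVector = K.toVector + M.toVector := by
  ext1
  funext g
  rw [VectorAlgebra.toFun_add, Pi.add_apply]
  simp only [toFun_toVector]
  rw [← weightedShift_add]
  congr 1
  ext x
  exact add_mul _ _ _

theorem toVector_smul (c : ℂ) (K : KernelAlgebra L 𝒜 ω) :
    (c • K).toVector = c • K.toVector := by
  ext1
  funext g
  rw [VectorAlgebra.toFun_smul, Pi.smul_apply]
  simp only [toFun_toVector]
  rw [← weightedShift_smul]
  congr 1
  ext x
  exact mul_assoc _ _ _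

/-- The product of the `h`-th and `(h⁻¹g)`-th diagonals sits on the `g`-th one; the sum over `h` is
the sum over the intermediate point `h⁻¹x` of the kernel composition. -/
theorem toVector_mul (K M : KernelAlgebra L 𝒜 ω) :
    (K * M).toVector = K.toVector * M.toVector := by
  ext1
  funext g
  refine ContinuousLinearMap.ext fun ξ => lp.ext (funext fun x => ?_)
  -- The convolution series converges in operator norm, so it may be applied to `ξ` and evaluated at
  -- `x` term by term.
  have hs := ((VectorAlgebra.summable_mul K.toVector M.toVector g).hasSum.mapL
    (ContinuousLinearMap.apply ℂ _ ξ)).mapL (lp.evalCLM ℂ (fun _ : G => ℂ) 2 x)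
  refine Eq.trans ?_ hs.tsum_eq
  have e : (K * M).toFun x (g⁻¹ * x) = ∑' h, K.toFun x (h⁻¹ * x) * M.toFun (h⁻¹ * x) (g⁻¹ * x)
      * ω.weight x (h⁻¹ * x) (g⁻¹ * x) :=
    (((Equiv.inv G).trans (Equiv.mulRight x)).tsum_eq _).symm
  rw [toFun_toVector, weightedShift_apply, diagonal_apply, e, mul_assoc, ← tsum_mul_right]
  refine tsum_congr fun h => ?_
  have hγ := ω.gauge_mul_gauge x (h⁻¹ * x) (g⁻¹ * x)
  have hg : (h⁻¹ * g)⁻¹ * (h⁻¹ * x) = g⁻¹ * x := by group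
  change _ = K.diagonal h x * (M.diagonal (h⁻¹ * g) (h⁻¹ * x) * ξ ((h⁻¹ * g)⁻¹ * (h⁻¹ * x)))
  rw [diagonal_apply, diagonal_apply, hg]
  -- Each pair of terms differs only by the coboundary relation along `x`, `h⁻¹x`, `g⁻¹x`.
  linear_combination (-K.toFun x (h⁻¹ * x) * M.toFun (h⁻¹ * x) (g⁻¹ * x) * ξ (g⁻¹ * x)) * hγ

theorem toVector_star (K : KernelAlgebra L 𝒜 ω) : (star K).toVector = star K.toVector := by
  ext1
  funext g
  rw [VectorAlgebra.toFun_star, invol]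
  simp only [toFun_toVector]
  rw [star_weightedShift, inv_inv]
  congr 1
  ext x
  simp [adj_eq, ← ω.star_weight_mul_gauge, mul_left_comm, mul_comm]

theorem toVector_one : (1 : KernelAlgebra L 𝒜 ω).toVector = 1 := by
  ext1
  funext g
  refine ContinuousLinearMap.ext fun ξ => lp.ext (funext fun x => ?_)
  by_cases hg : g = 1
  · simp [hg, VectorAlgebra.delta, unitKernel, ω.gauge_self]
  · simp [hg, VectorAlgebra.delta, unitKernel]

/-- The isometric embedding of the algebra of twisted kernels in `𝓛(G; B(ℓ²(G)))`. -/
def toVectorHom : KernelAlgebra L 𝒜 ω →ₐ[ℂ]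
    VectorAlgebra L (lp (fun _ : G => ℂ) 2 →L[ℂ] lp (fun _ : G => ℂ) 2) :=
  AlgHom.ofLinearMap
    { toFun := toVector
      map_add' := toVector_add
      map_smul' := toVector_smul } toVector_one toVector_mul

theorem isometry_toVectorHom : Isometry (toVectorHom (L := L) (ω := ω)) :=
  AddMonoidHomClass.isometry_of_norm _ norm_toVector

end KernelAlgebra

end TwistedKernel

end

/-! ### Descent of symmetry to the kernel algebra. -/

theorem mainTheorem11 {G : Type u} [Group G] (L : TwistedKernel.AdmissibleAlgebra G)
    (hG : TwistedKernel.IsRigidlySymmetric L)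
    (𝒜 : TwistedKernel.InvariantSubalgebra G) (ω : TwistedKernel.TwoCocycle 𝒜) :
    TwistedKernel.IsSymmetric (TwistedKernel.KernelAlgebra L 𝒜 ω) := by
  intro K z hz
  rw [mem_quasispectrum_iff] at hz
  -- The kernel algebra is unital, so its quasispectrum is the spectrum together with `0`.
  rcases hz with rfl | hz
  · exact le_rfl
  refine TwistedKernel.spectrum_nonneg_of_isometry _
    TwistedKernel.KernelAlgebra.isometry_toVectorHom _ (fun w hw => ?_) z hz
  -- Rigid symmetry is applied to the single C*-algebra `B(ℓ²(G))`; the image of `K* K` has the form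
  -- `b* b` because the embedding respects products and involutions.
  refine hG _ K.toVector w ?_
  rw [← TwistedKernel.KernelAlgebra.toVector_star, ← TwistedKernel.KernelAlgebra.toVector_mul]
  exact spectrum_subset_quasispectrum ℂ _ hw
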